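/- Let $\mathcal C$ be a class of groups, closed under isomorphism and consisting only of periodic groups. Assume that $\mathcal C$ is a root class, i.e. it contains at least one non-trivial group and is closed under taking subgroups, extensions, and Cartesian products of the form $\prod_{y\in Y}X_y$, where $X,Y\in\mathcal C$ and $X_y$ is an isomorphic copy of $X$ for each $y\in Y$. Let $\mathfrak P(\mathcal C)$ be the set of primes each of which divides the order of an element of some group in $\mathcal C$. A subgroup $Y$ of a group $X$ is called *$\mathcal C$-separable* if for every $x\in X\setminus Y$ there is a homomorphism $\sigma$ of $X$ onto a group from $\mathcal C$ with $\sigma(x)\notin\sigma(Y)$. It is called *$\mathfrak P(\mathcal C)'$-isolated* if for every $x\in X$ and every prime $q\notin\mathfrak P(\mathcal C)$, $x^q\in Y$ implies $x\in Y$. The group $X$ has the *property $\mathcal C$-$\mathfrak{Sep}$* if all its $\mathfrak P(\mathcal C)'$-isolated subgroups are $\mathcal C$-separable. An abelian group $A$ is *$\mathcal C$-bounded* if, for every quotient group $B$ of $A$ and every $p\in\mathfrak P(\mathcal C)$, the $p$-power torsion subgroup of $B$ has finite exponent and its cardinality does not exceed the cardinality of some group in $\mathcal C$. A nilpotent group is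 *$\mathcal C$-bounded* if it has at least one finite central series whose factors are $\mathcal C$-bounded abelian groups. Then a torsion-free nilpotent group $X$ has the property $\mathcal C$-$\mathfrak{Sep}$ if and only if it is $\mathcal C$-bounded. -/

import Mathlib

universe u

/-- A class of groups (in a fixed universe); invariance under isomorphism is part of `IsRoot`. -/
abbrev GroupClass : Type (u + 1) := ∀ (G : Type u) [Group G], Prop

namespace GroupClass

/-- A root class of groups: an isomorphism-closed class which contains a non-trivial group and is
closed under subgroups, extensions and the Cartesian powers `∏_{y ∈ Y} X`, where `X` and `Y` are
in the class. -/
structure IsRoot (C : GroupClass.{u}) : Prop where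
  iso : ∀ (G H : Type u) [Group G] [Group H], Nonempty (G ≃* H) → C G → C H
  nontrivial : ∃ (G : Type u) (_ : Group G), C G ∧ Nontrivial G
  subgroup : ∀ (G : Type u) [Group G] (H : Subgroup G), C G → C H
  extension : ∀ (G : Type u) [Group G] (N : Subgroup G) [N.Normal], C N → C (G ⧸ N) → C G
  cartesianPower : ∀ (X Y : Type u) [Group X] [Group Y], C X → C Y → C (Y → X)

/-- The class consists only of periodic groups. -/
def IsPeriodic (C : GroupClass.{u}) : Prop :=
  ∀ (G : Type u) [Group G], C G → IsMulTorsion G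

/-- The set `𝔓(C)` of all primes that divide the (finite) order of an element of some
`C`-group. -/
def primes (C : GroupClass.{u}) : Set ℕ :=
  {p | p.Prime ∧ ∃ (G : Type u) (_ : Group G), C G ∧ ∃ g : G, IsOfFinOrder g ∧ p ∣ orderOf g}

/-- `Y` is separable in `X` by the class `C`: every element outside `Y` is mapped outside the image
of `Y` by some homomorphism of `X` onto a `C`-group. -/
def IsSeparable (C : GroupClass.{u}) {X : Type u} [Group X] (Y : Subgroup X) : Prop :=
  ∀ x : X, x ∉ Y → ∃ (K : Type u) (_ : Group K) (σ : X →* K),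
    C K ∧ Function.Surjective σ ∧ σ x ∉ Y.map σ

end GroupClass

/-- `Y` is `P'`-isolated in `X`, where `P'` is the set of the primes not in `P`. -/
def Subgroup.IsComplIsolated (P : Set ℕ) {X : Type u} [Group X] (Y : Subgroup X) : Prop :=
  ∀ (x : X) (q : ℕ), q.Prime → q ∉ P → x ^ q ∈ Y → x ∈ Y

/-- The set of all elements whose order is a power of `p`. In an abelian group this is the
`p`-power torsion subgroup. -/
def pPowerTorsion (p : ℕ) (B : Type u) [Group B] : Set B :=
  {b | ∃ k : ℕ, b ^ p ^ k = 1}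

namespace GroupClass

/-- The property `C-𝔖𝔢𝔭`: all `𝔓(C)'`-isolated subgroups of `X` are `C`-separable. -/
def HasSep (C : GroupClass.{u}) (X : Type u) [Group X] : Prop :=
  ∀ Y : Subgroup X, Y.IsComplIsolated C.primes → C.IsSeparable Y

/-- `A` is a `C`-bounded abelian group: for every quotient `B` of `A`, every primary
`𝔓(C)`-component of `B` has finite exponent and a cardinality not exceeding the cardinality of
some `C`-group. -/
structure IsBoundedAbelian (C : GroupClass.{u}) (A : Type u) [Group A] : Prop where
  comm : ∀ a b : A, a * b = b * a
  exponent : ∀ (M : Subgroup A) [M.Normal], ∀ p ∈ C.primes,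
    ∃ n : ℕ, 0 < n ∧ ∀ b ∈ pPowerTorsion p (A ⧸ M), b ^ n = 1
  card : ∀ (M : Subgroup A) [M.Normal], ∀ p ∈ C.primes,
    ∃ (K : Type u) (_ : Group K), C K ∧ Cardinal.mk (pPowerTorsion p (A ⧸ M)) ≤ Cardinal.mk K

/-- `X` is a `C`-bounded nilpotent group: it has a finite central series
`1 = H 0 ≤ H 1 ≤ ⋯ ≤ H n = X` whose factors `H (i + 1) / H i` are `C`-bounded abelian groups.
The terms of `H` beyond `n` play no role. -/
def IsBoundedNilpotent (C : GroupClass.{u}) (X : Type u) [Group X] : Prop :=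
  ∃ (n : ℕ) (H : ℕ → Subgroup X) (_ : ∀ i, (H i).Normal),
    H 0 = ⊥ ∧ H n = ⊤ ∧
    (∀ i < n, H i ≤ H (i + 1) ∧ ⁅H (i + 1), (⊤ : Subgroup X)⁆ ≤ H i) ∧
    ∀ i < n, C.IsBoundedAbelian (H (i + 1) ⧸ (H i).subgroupOf (H (i + 1)))

end GroupClass

/-! Bounded implies separable: for `x ∉ Y` take the lowest term of the central series whose product
with `Y` contains some `x ^ m`, where no prime divisor of `m` lies in `𝔓(C)`. As `Y` is isolated,
this is not the trivial term; modulo the preceding term `x ^ m = y * h` with `h` central, and it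
remains to separate `h` from `Y`. Some power of `h` lies outside an overgroup of `Y` that contains
its `p`-th power, with `p ∈ 𝔓(C)`. Enlarge the overgroup to a subgroup `V` maximal without that
power. The quotient by the core of `V` has a `p`-primary centre
(`Subgroup.center_quotient_normalCore_le`), and boundedness puts such a quotient in `C`
(`IsRoot.of_isBoundedNilpotent`).

Conversely, groups in `C` have finite exponent, so their homomorphisms cannot detect a divisible
`p`-section in a factor of the upper central series, and separability excludes such sections
(`HasSep.hasNoDivisibleSection`). A torsion-free abelian group without them has `A / pA` finite,
hence finite `p`-torsion in every quotient (`HasNoDivisibleSection.finite_pPrimary`). -/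

open scoped commutatorElement

/-! ### Root classes and their abelian members. -/

namespace GroupClass

variable {C : GroupClass.{u}}

theorem IsRoot.of_injective (hC : C.IsRoot) {G H : Type u} [Group G] [Group H] (f : G →* H)
    (hf : Function.Injective f) (h : C H) : C G :=
  hC.iso f.range G ⟨(MonoidHom.ofInjective hf).symm⟩ (hC.subgroup H f.range h)

theorem IsRoot.of_subsingleton (hC : C.IsRoot) {G : Type u} [Group G] [Subsingleton G] : C G := by
  obtain ⟨H, _, hH, -⟩ := hC.nontrivial
  exact hC.of_injective (1 : G →* H) (fun _ _ _ => Subsingleton.elim _ _) hH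

theorem IsRoot.of_surjective_of_ker (hC : C.IsRoot) {G Q : Type u} [Group G] [Group Q] (f : G →* Q)
    (hf : Function.Surjective f) (hQ : C Q) (hK : C f.ker) : C G :=
  hC.extension G f.ker hK
    (hC.iso Q (G ⧸ f.ker) ⟨(QuotientGroup.quotientKerEquivOfSurjective f hf).symm⟩ hQ)

/-- The identity function is an element of finite order of the Cartesian power `G → G`. -/
theorem IsRoot.exists_pow_eq_one (hC : C.IsRoot) (hper : C.IsPeriodic) {G : Type u} [Group G]
    (h : C G) : ∃ n : ℕ, 0 < n ∧ ∀ g : G, g ^ n = 1 := by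
  have h1 := hper (G → G) (hC.cartesianPower G G h h) id
  obtain ⟨n, hn, hpow⟩ := isOfFinOrder_iff_pow_eq_one.mp h1
  exact ⟨n, hn, fun g => by simpa using congrFun hpow g⟩

theorem IsRoot.exists_mem_primes (hC : C.IsRoot) (hper : C.IsPeriodic) : ∃ p, p ∈ C.primes := by
  obtain ⟨G, _, hG, hnt⟩ := hC.nontrivial
  obtain ⟨g, hg⟩ := exists_ne (1 : G)
  have h1 : orderOf g ≠ 1 := fun h => hg (orderOf_eq_one_iff.mp h)
  obtain ⟨p, hp, hpg⟩ := Nat.exists_prime_and_dvd h1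
  exact ⟨p, hp, G, _, hG, g, hper G hG g, hpg⟩

theorem IsRoot.zmod (hC : C.IsRoot) {p : ℕ} (hp : p ∈ C.primes) :
    C (ULift.{u} (Multiplicative (ZMod p))) := by
  obtain ⟨hpp, G, _, hG, g, hg, hpg⟩ := hp
  have hord : orderOf (g ^ (orderOf g / p)) = p :=
    orderOf_pow_orderOf_div (orderOf_pos_iff.mpr hg).ne' hpg
  have e : Multiplicative (ZMod p) ≃* Subgroup.zpowers (g ^ (orderOf g / p)) :=
    mulEquivOfCyclicCardEq (by rw [Nat.card_zpowers, hord]; exact Nat.card_zmod p)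
  exact hC.iso _ _ ⟨e.symm.trans MulEquiv.ulift.symm⟩ (hC.subgroup G _ hG)

/-- By Cantor, the power of `ZMod p` indexed by `K` is strictly larger than `K`. -/
theorem IsRoot.exists_le_card (hC : C.IsRoot) (hper : C.IsPeriodic) (n : ℕ) :
    ∃ (K : Type u) (_ : Group K), C K ∧ (n : Cardinal.{u}) ≤ Cardinal.mk K := by
  obtain ⟨p, hp⟩ := hC.exists_mem_primes hper
  induction n with
  | zero =>
    obtain ⟨G, _, hG, hnt⟩ := hC.nontrivial
    exact ⟨G, _, hG, by simp⟩
  | succ n ih =>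
    obtain ⟨K, _, hK, hn⟩ := ih
    refine ⟨K → ULift.{u} (Multiplicative (ZMod p)), inferInstance,
      hC.cartesianPower _ _ (hC.zmod hp) hK, ?_⟩
    have : Fact (1 < p) := ⟨hp.1.one_lt⟩
    have h2 : (2 : Cardinal.{u}) ≤ Cardinal.mk (ULift.{u} (Multiplicative (ZMod p))) :=
      Cardinal.two_le_iff.mpr ⟨_, _, (exists_pair_ne _).choose_spec.choose_spec⟩
    have hlt : (n : Cardinal.{u}) < Cardinal.mk (K → ULift.{u} (Multiplicative (ZMod p))) := by
      rw [← Cardinal.power_def]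
      exact (hn.trans_lt (Cardinal.cantor _)).trans_le (Cardinal.power_le_power_right h2)
    rw [Nat.cast_succ]
    exact Cardinal.add_one_le_of_lt hlt

/-- A basis of `V` over `ZMod p` embeds in `V`, hence in `K`, so `V` embeds in the power of `ZMod p`
indexed by `K`. -/
theorem IsRoot.of_elementary (hC : C.IsRoot) {p : ℕ} (hp : p ∈ C.primes) {V K : Type u}
    [CommGroup V] [Group K] (hK : C K) (hcard : Cardinal.mk V ≤ Cardinal.mk K)
    (hV : ∀ v : V, v ^ p = 1) : C V := by
  have : Fact p.Prime := ⟨hp.1⟩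
  let _ : Module (ZMod p) (Additive V) := AddCommGroup.zmodModule (n := p) hV
  obtain ⟨e⟩ : Nonempty (V ↪ K) := hcard
  let b := Module.Basis.ofVectorSpace (ZMod p) (Additive V)
  let j : Module.Basis.ofVectorSpaceIndex (ZMod p) (Additive V) → K := fun i => e i.1.toMul
  have hj : Function.Injective j := fun i i' h => Subtype.ext (Additive.toMul.injective (e.injective h))
  let f : V →* (K → ULift.{u} (Multiplicative (ZMod p))) :=
    -- Coordinates sit at the images of basis vectors in `K`; all other places get the value `1`.
    { toFun := fun v => Function.extend j
        (fun i => ULift.up (Multiplicative.ofAdd (b.repr (Additive.ofMul v) i))) 1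
      map_one' := by
        have : (fun i => ULift.up.{u} (Multiplicative.ofAdd (b.repr (Additive.ofMul (1 : V)) i)))
            = 1 := by
          funext i; simp; rfl
        rw [this]; exact Function.extend_one j
      map_mul' := fun v w => by
        rw [← Function.extend_mul, one_mul]
        congr 1
        funext i; simp; rfl }
  refine hC.of_injective f (fun v w h => ?_) (hC.cartesianPower _ _ (hC.zmod hp) hK)
  apply Additive.ofMul.injective
  apply b.repr.injective
  ext i
  have := congrFun h (j i)
  simp only [f, MonoidHom.coe_mk, OneHom.coe_mk, hj.extend_apply] at this
  exact Multiplicative.ofAdd.injective (ULift.up.inj this)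

/-- The map `b ↦ b ^ p` has an elementary kernel and an image of smaller exponent. -/
theorem IsRoot.of_comm_of_pow_eq_one (hC : C.IsRoot) {p : ℕ} (hp : p ∈ C.primes) {K : Type u}
    [Group K] (hK : C K) (e : ℕ) : ∀ (B : Type u) [CommGroup B], Cardinal.mk B ≤ Cardinal.mk K →
      (∀ b : B, b ^ p ^ e = 1) → C B := by
  induction e with
  | zero =>
    intro B _ _ h
    have : Subsingleton B := ⟨fun a b => by simpa using (h a).trans (h b).symm⟩
    exact hC.of_subsingleton
  | succ e ih =>
    intro B _ hcard h
    let f := (powMonoidHom p : B →* B).rangeRestrict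
    refine hC.of_surjective_of_ker f (MonoidHom.rangeRestrict_surjective _) (ih _ ?_ ?_)
      (hC.of_elementary hp hK ?_ ?_)
    · exact (Cardinal.mk_set_le _).trans hcard
    · rintro ⟨_, b, rfl⟩
      ext
      simpa [← pow_mul, ← pow_succ'] using h b
    · exact (Cardinal.mk_set_le _).trans hcard
    · rintro ⟨b, hb⟩
      ext
      simpa [f, MonoidHom.mem_ker, Subtype.ext_iff] using hb

end GroupClass

/-! ### Quotients of bounded groups. -/

namespace GroupClass

variable {C : GroupClass.{u}}

theorem IsBoundedAbelian.of_surjective {A B : Type u} [Group A] [Group B]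
    (hA : C.IsBoundedAbelian A) (f : A →* B) (hf : Function.Surjective f) :
    C.IsBoundedAbelian B := by
  have key : ∀ (M : Subgroup B) [M.Normal], Nonempty ((A ⧸ M.comap f) ≃* (B ⧸ M)) := by
    intro M _
    have hs : Function.Surjective ((QuotientGroup.mk' M).comp f) :=
      (QuotientGroup.mk'_surjective M).comp hf
    have hk : M.comap f = ((QuotientGroup.mk' M).comp f).ker := by
      rw [← MonoidHom.comap_ker, QuotientGroup.ker_mk']
    exact ⟨(QuotientGroup.quotientMulEquivOfEq hk).trans
      (QuotientGroup.quotientKerEquivOfSurjective _ hs)⟩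
  refine ⟨?_, ?_, ?_⟩
  · intro a b
    obtain ⟨a, rfl⟩ := hf a
    obtain ⟨b, rfl⟩ := hf b
    rw [← map_mul, hA.comm, map_mul]
  · intro M _ p hp
    obtain ⟨e⟩ := key M
    obtain ⟨n, hn, h⟩ := hA.exponent (M.comap f) p hp
    refine ⟨n, hn, fun b hb => e.symm.injective ?_⟩
    rw [map_pow, map_one]
    refine h _ ?_
    obtain ⟨k, hk⟩ := hb
    exact ⟨k, by rw [← map_pow, hk, map_one]⟩
  · intro M _ p hp
    obtain ⟨e⟩ := key M
    obtain ⟨K, _, hK, h⟩ := hA.card (M.comap f) p hp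
    refine ⟨K, _, hK, le_trans ?_ h⟩
    refine Cardinal.mk_le_of_injective (f := fun b => ⟨e.symm b.1, ?_⟩) ?_
    · obtain ⟨b, k, hk⟩ := b
      exact ⟨k, by rw [← map_pow, hk, map_one]⟩
    · intro b b' h
      exact Subtype.ext (e.symm.injective (Subtype.ext_iff.mp h))

theorem IsBoundedAbelian.exists_pow_eq_one {A : Type u} [Group A] (hA : C.IsBoundedAbelian A)
    {p : ℕ} (hp : p ∈ C.primes) : ∃ n : ℕ, 0 < n ∧ ∀ a ∈ pPowerTorsion p A, a ^ n = 1 := by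
  obtain ⟨n, hn, h⟩ := hA.exponent ⊥ p hp
  refine ⟨n, hn, fun a ⟨k, hk⟩ => ?_⟩
  have := h (a : A ⧸ (⊥ : Subgroup A)) ⟨k, by rw [← QuotientGroup.mk_pow, hk]; rfl⟩
  rwa [← QuotientGroup.mk_pow, QuotientGroup.eq_one_iff, Subgroup.mem_bot] at this

theorem IsBoundedAbelian.exists_card_le {A : Type u} [Group A] (hA : C.IsBoundedAbelian A)
    {p : ℕ} (hp : p ∈ C.primes) (ht : ∀ a : A, a ∈ pPowerTorsion p A) :
    ∃ (K : Type u) (_ : Group K), C K ∧ Cardinal.mk A ≤ Cardinal.mk K := by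
  obtain ⟨K, _, hK, h⟩ := hA.card ⊥ p hp
  refine ⟨K, _, hK, le_trans ?_ h⟩
  refine Cardinal.mk_le_of_injective (f := fun a => ⟨(a : A ⧸ (⊥ : Subgroup A)), ?_⟩) ?_
  · obtain ⟨k, hk⟩ := ht a
    exact ⟨k, by rw [← QuotientGroup.mk_pow, hk]; rfl⟩
  · intro a b h
    have := QuotientGroup.eq.mp (Subtype.ext_iff.mp h)
    rw [Subgroup.mem_bot] at this
    exact inv_mul_eq_one.mp this

theorem IsBoundedNilpotent.of_surjective {X Q : Type u} [Group X] [Group Q]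
    (hX : C.IsBoundedNilpotent X) (f : X →* Q) (hf : Function.Surjective f) :
    C.IsBoundedNilpotent Q := by
  obtain ⟨n, H, hN, h0, hn, hc, hb⟩ := hX
  have hN' : ∀ i, ((H i).map f).Normal := fun i => (hN i).map f hf
  refine ⟨n, fun i => (H i).map f, hN', by simp [h0], ?_, fun i hi => ⟨?_, ?_⟩, fun i hi => ?_⟩
  · simp only [hn]
    exact Subgroup.map_top_of_surjective f hf
  · exact Subgroup.map_mono (hc i hi).1
  · have := Subgroup.map_mono (f := f) (hc i hi).2
    rwa [Subgroup.map_commutator, Subgroup.map_top_of_surjective f hf] at this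
  · refine (hb i hi).of_surjective
      (QuotientGroup.map _ _ (f.subgroupMap (H (i + 1))) ?_) ?_
    · intro x hx
      exact ⟨x.1, hx, rfl⟩
    · apply QuotientGroup.map_surjective_of_surjective
      exact (QuotientGroup.mk'_surjective _).comp (f.subgroupMap_surjective _)

end GroupClass

/-! ### Bounded nilpotent groups with `p`-primary centre. -/

theorem commutatorElement_pow_left_of_commute {G : Type*} [Group G] {a b : G}
    (h : Commute a ⁅a, b⁆) (n : ℕ) : ⁅a ^ n, b⁆ = ⁅a, b⁆ ^ n := by
  have h1 : a ^ n * b = ⁅a, b⁆ ^ n * b * a ^ n := by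
    induction n with
    | zero => simp
    | succ n ih =>
      calc a ^ (n + 1) * b = a * (a ^ n * b) := by rw [pow_succ', mul_assoc]
        _ = (a * ⁅a, b⁆ ^ n) * b * a ^ n := by rw [ih]; group
        _ = ⁅a, b⁆ ^ n * (a * b) * a ^ n := by rw [(h.pow_right n).eq]; group
        _ = ⁅a, b⁆ ^ n * (⁅a, b⁆ * b * a) * a ^ n := by
          congr 2; rw [commutatorElement_def]; group
        _ = _ := by rw [pow_succ, pow_succ']; group
  rw [commutatorElement_def (a ^ n), h1]
  group

/-- With `N` a term of the upper central series, this transfers information on powers from one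
central factor to the next. -/
theorem Subgroup.commutatorElement_pow_mem_iff {G : Type*} [Group G] (N : Subgroup G) [N.Normal]
    {a b : G} (h : ⁅⁅a, b⁆, a⁆ ∈ N) (n : ℕ) : ⁅a ^ n, b⁆ ∈ N ↔ ⁅a, b⁆ ^ n ∈ N := by
  have key : ∀ x y : G, ((⁅x, y⁆ : G) : G ⧸ N) = ⁅(x : G ⧸ N), (y : G ⧸ N)⁆ := fun x y => rfl
  have h1 : Commute (a : G ⧸ N) ⁅(a : G ⧸ N), (b : G ⧸ N)⁆ := by
    rw [← QuotientGroup.eq_one_iff, key, key, commutatorElement_eq_one_iff_commute] at h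
    exact h.symm
  rw [← QuotientGroup.eq_one_iff, ← QuotientGroup.eq_one_iff, key, QuotientGroup.mk_pow,
    QuotientGroup.mk_pow, key, commutatorElement_pow_left_of_commute h1]

/-- A nilpotent group of class `c` whose centre has exponent dividing `m` has exponent
dividing `m ^ c`. -/
theorem Group.IsNilpotent.exists_pow_eq_one {Q : Type*} [Group Q] [Group.IsNilpotent Q] {m : ℕ}
    (hm : ∀ z ∈ Subgroup.center Q, z ^ m = 1) : ∃ c : ℕ, ∀ g : Q, g ^ m ^ c = 1 := by
  have step : ∀ i, ∀ z ∈ Subgroup.upperCentralSeries Q (i + 1),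
      z ^ m ∈ Subgroup.upperCentralSeries Q i := by
    intro i
    induction i with
    | zero =>
      intro z hz
      rw [zero_add, Subgroup.upperCentralSeries_one] at hz
      rw [Subgroup.upperCentralSeries_zero, Subgroup.mem_bot]
      exact hm z hz
    | succ i ih =>
      intro z hz
      rw [Subgroup.mem_upperCentralSeries_succ_iff] at hz ⊢
      intro y
      rw [Subgroup.commutatorElement_pow_mem_iff _
        (Subgroup.mem_upperCentralSeries_succ_iff.mp (hz y) z)]
      exact ih _ (hz y)
  have hi : ∀ i, ∀ z ∈ Subgroup.upperCentralSeries Q i, z ^ m ^ i = 1 := by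
    intro i
    induction i with
    | zero => intro z hz; simpa using hz
    | succ i ih =>
      intro z hz
      rw [pow_succ', pow_mul]
      exact ih _ (step i z hz)
  exact ⟨Group.nilpotencyClass Q, fun g => hi _ g (by simp)⟩

namespace GroupClass

variable {C : GroupClass.{u}}

theorem IsBoundedNilpotent.exists_center_pow_eq_one {Q : Type u} [Group Q]
    (hQ : C.IsBoundedNilpotent Q) {p : ℕ} (hp : p ∈ C.primes)
    (hz : ∀ z ∈ Subgroup.center Q, z ∈ pPowerTorsion p Q) :
    ∃ e : ℕ, ∀ z ∈ Subgroup.center Q, z ^ p ^ e = 1 := by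
  obtain ⟨n, H, hN, h0, hn, hc, hb⟩ := hQ
  have main : ∀ i ≤ n, ∃ m : ℕ, 0 < m ∧ ∀ z ∈ Subgroup.center Q, z ∈ H i → z ^ m = 1 := by
    intro i
    induction i with
    | zero => exact fun _ => ⟨1, one_pos, fun z _ h => by simpa [h0] using h⟩
    | succ i ih =>
      intro hi
      obtain ⟨m, hm, h⟩ := ih (by omega)
      obtain ⟨m', hm', h'⟩ := (hb i hi).exists_pow_eq_one hp
      refine ⟨m' * m, Nat.mul_pos hm' hm, fun z hzc hzH => ?_⟩
      rw [pow_mul]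
      refine h _ (pow_mem hzc _) ?_
      have h2 := h' ((⟨z, hzH⟩ : H (i + 1)) : H (i + 1) ⧸ (H i).subgroupOf (H (i + 1))) (by
        obtain ⟨k, hk⟩ := hz z hzc
        refine ⟨k, ?_⟩
        rw [← QuotientGroup.mk_pow, QuotientGroup.eq_one_iff, Subgroup.mem_subgroupOf]
        simp [hk])
      rw [← QuotientGroup.mk_pow, QuotientGroup.eq_one_iff, Subgroup.mem_subgroupOf] at h2
      simpa using h2
  obtain ⟨m, hm, h⟩ := main n le_rfl
  -- The order `p ^ j` of `z` divides `m`, so `j < p ^ j ≤ m`, and `p ^ m` serves for all `z`.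
  refine ⟨m, fun z hzc => ?_⟩
  obtain ⟨k, hk⟩ := hz z hzc
  obtain ⟨j, -, hj⟩ := (Nat.dvd_prime_pow hp.1).mp (orderOf_dvd_of_pow_eq_one hk)
  have h1 : p ^ j ≤ m := Nat.le_of_dvd hm (hj ▸ orderOf_dvd_of_pow_eq_one
    (h z hzc (by rw [hn]; exact Subgroup.mem_top z)))
  have h2 : j ≤ m := (Nat.lt_pow_self hp.1.one_lt).le.trans h1
  exact orderOf_dvd_iff_pow_eq_one.mp (hj ▸ pow_dvd_pow p h2)

/-- The exponent of the centre bounds that of `Q`, so each factor of the series is all `p`-torsion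
and its whole cardinality is bounded. The series is then climbed by extensions. -/
theorem IsRoot.of_isBoundedNilpotent (hC : C.IsRoot) {Q : Type u} [Group Q] [Group.IsNilpotent Q]
    (hQ : C.IsBoundedNilpotent Q) {p : ℕ} (hp : p ∈ C.primes)
    (hz : ∀ z ∈ Subgroup.center Q, z ∈ pPowerTorsion p Q) : C Q := by
  obtain ⟨e, he⟩ := hQ.exists_center_pow_eq_one hp hz
  obtain ⟨c, hc'⟩ := Group.IsNilpotent.exists_pow_eq_one he
  simp only [← pow_mul] at hc'
  obtain ⟨n, H, hN, h0, hn, hc, hb⟩ := hQ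
  have main : ∀ i ≤ n, C (H i) := by
    intro i
    induction i with
    | zero =>
      intro _
      have : Subsingleton (H 0) := by rw [h0]; infer_instance
      exact hC.of_subsingleton
    | succ i ih =>
      intro hi
      have hpow : ∀ a : H (i + 1) ⧸ (H i).subgroupOf (H (i + 1)), a ^ p ^ (e * c) = 1 := by
        intro a
        obtain ⟨x, rfl⟩ := QuotientGroup.mk_surjective a
        rw [← QuotientGroup.mk_pow, QuotientGroup.eq_one_iff, Subgroup.mem_subgroupOf]
        simp [hc']
      obtain ⟨K, _, hK, hcard⟩ := (hb i hi).exists_card_le hp fun a => ⟨_, hpow a⟩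
      refine hC.extension _ ((H i).subgroupOf (H (i + 1)))
        (hC.iso _ _ ⟨(Subgroup.subgroupOfEquivOfLe (hc i hi).1).symm⟩ (ih (by omega))) ?_
      let _ : CommGroup (H (i + 1) ⧸ (H i).subgroupOf (H (i + 1))) :=
        { (inferInstance : Group (H (i + 1) ⧸ (H i).subgroupOf (H (i + 1)))) with
          mul_comm := (hb i hi).comm }
      exact hC.of_comm_of_pow_eq_one hp hK (e * c) _ hcard hpow
  have h1 := main n le_rfl
  rw [hn] at h1
  exact hC.iso _ _ ⟨Subgroup.topEquiv⟩ h1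

end GroupClass

/-! ### Subgroups maximal without a given central element. -/

theorem Subgroup.exists_le_maximal_notMem {G : Type*} [Group G] (Y : Subgroup G) {g : G}
    (hg : g ∉ Y) : ∃ V : Subgroup G, Y ≤ V ∧ g ∉ V ∧ ∀ W, V < W → g ∈ W := by
  obtain ⟨V, hYV, hV⟩ := zorn_le_nonempty₀ {V : Subgroup G | g ∉ V} (fun c hc hch V hV => by
    refine ⟨sSup c, fun h => ?_, fun W hW => le_sSup hW⟩
    obtain ⟨W, hW, hgW⟩ := (Subgroup.mem_sSup_of_directedOn ⟨V, hV⟩ hch.directedOn).mp h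
    exact hc hW hgW) Y hg
  exact ⟨V, hYV, hV.prop, fun W hW => by_contra fun h => hV.not_gt h hW⟩

/-- If `V` is maximal among the subgroups which do not contain the central element `g` and
`g ^ p ∈ V`, then the quotient by the normal core of `V` has a `p`-primary centre. -/
theorem Subgroup.center_quotient_normalCore_le {G : Type u} [Group G] {V : Subgroup G} {g : G}
    {p : ℕ} (hp : p.Prime) (hgc : g ∈ Subgroup.center G) (hg : g ∉ V) (hgp : g ^ p ∈ V)
    (hV : ∀ W, V < W → g ∈ W) :
    ∀ z ∈ Subgroup.center (G ⧸ V.normalCore), z ∈ pPowerTorsion p (G ⧸ V.normalCore) := by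
  -- If `v` is central modulo the core, its conjugates differ from it by core elements and so remain
  -- in `V`.
  have hcore : ∀ v ∈ V, (v : G ⧸ V.normalCore) ∈ Subgroup.center (G ⧸ V.normalCore) →
      v ∈ V.normalCore := by
    intro v hv hvc b
    have h1 := (Subgroup.mem_center_iff.mp hvc) (b : G ⧸ V.normalCore)
    have h2 : (v : G ⧸ V.normalCore) = ((b * v * b⁻¹ : G) : G ⧸ V.normalCore) := by
      rw [QuotientGroup.mk_mul, QuotientGroup.mk_mul, h1, QuotientGroup.mk_inv,
        mul_inv_cancel_right]
    have h3 := mul_mem hv (Subgroup.normalCore_le V (QuotientGroup.eq.mp h2))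
    rwa [mul_inv_cancel_left] at h3
  have hgc' : ∀ k : ℤ, ((g ^ k : G) : G ⧸ V.normalCore) ∈ Subgroup.center (G ⧸ V.normalCore) := by
    intro k
    rw [Subgroup.mem_center_iff]
    intro q
    obtain ⟨x, rfl⟩ := QuotientGroup.mk_surjective q
    rw [← QuotientGroup.mk_mul, ← QuotientGroup.mk_mul,
      Subgroup.mem_center_iff.mp (zpow_mem hgc k) x]
  have hg1 : (g : G ⧸ V.normalCore) ≠ 1 := fun h =>
    hg (Subgroup.normalCore_le V ((QuotientGroup.eq_one_iff g).mp h))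
  have hgp1 : (g : G ⧸ V.normalCore) ^ p = 1 := by
    rw [← QuotientGroup.mk_pow, QuotientGroup.eq_one_iff]
    exact hcore _ hgp (by simpa using hgc' p)
  -- By maximality `g = v * w` with `v ∈ V` and `w` a power of `z` modulo the core. Then `v` is
  -- central modulo the core, hence trivial there.
  have key : ∀ z ∈ Subgroup.center (G ⧸ V.normalCore), z ≠ 1 →
      ∃ k : ℤ, (g : G ⧸ V.normalCore) = z ^ k := by
    intro z hz hz1
    obtain ⟨x, rfl⟩ := QuotientGroup.mk_surjective z
    have hxV : x ∉ V := fun h => hz1 ((QuotientGroup.eq_one_iff x).mpr (hcore x h hz))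
    let Z : Subgroup G := (Subgroup.zpowers (x : G ⧸ V.normalCore)).comap (QuotientGroup.mk' _)
    have hZn : Z.Normal := by
      have : (Subgroup.zpowers (x : G ⧸ V.normalCore)).Normal := by
        refine ⟨fun n hn y => ?_⟩
        rw [Subgroup.mem_center_iff.mp ((Subgroup.zpowers_le (H := Subgroup.center _)).mpr hz hn) y,
          mul_inv_cancel_right]
        exact hn
      exact Subgroup.Normal.comap this _
    have hxZ : x ∈ Z := Subgroup.mem_zpowers (x : G ⧸ V.normalCore)
    have hlt : V < V ⊔ Z := lt_of_le_of_ne le_sup_left fun h => hxV (h ▸ Subgroup.mem_sup_right hxZ)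
    obtain ⟨v, hv, w, hw, hvw⟩ := Subgroup.mem_sup_of_normal_right.mp (hV _ hlt)
    obtain ⟨k, hk⟩ := Subgroup.mem_zpowers_iff.mp hw
    have hk : (x : G ⧸ V.normalCore) ^ k = (w : G ⧸ V.normalCore) := hk
    refine ⟨k, ?_⟩
    have hvc : (v : G ⧸ V.normalCore) ∈ Subgroup.center (G ⧸ V.normalCore) := by
      have : (v : G ⧸ V.normalCore) = (g : G ⧸ V.normalCore) * ((x : G ⧸ V.normalCore) ^ k)⁻¹ := by
        rw [hk, ← hvw, QuotientGroup.mk_mul, mul_inv_cancel_right]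
      rw [this]
      exact mul_mem (by simpa using hgc' 1) (inv_mem (zpow_mem hz k))
    rw [hk, ← hvw, QuotientGroup.mk_mul, (QuotientGroup.eq_one_iff v).mpr (hcore v hv hvc), one_mul]
  intro z hz
  by_cases hz1 : z = 1
  · exact ⟨0, by simp [hz1]⟩
  obtain ⟨k, hk⟩ := key z hz hz1
  have hk0 : k ≠ 0 := fun h => hg1 (by rw [hk, h, zpow_zero])
  have hfin : IsOfFinOrder z := by
    refine isOfFinOrder_iff_zpow_eq_one.mpr ⟨k * p, mul_ne_zero hk0 (by exact_mod_cast hp.ne_zero), ?_⟩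
    rw [zpow_mul, ← hk, zpow_natCast, hgp1]
  obtain ⟨s, m, hm, hsm⟩ := Nat.exists_eq_pow_mul_and_not_dvd (orderOf_pos_iff.mpr hfin).ne' p hp.ne_one
  -- Otherwise `g` would be a power of `z ^ p ^ s`, whose order is the prime-to-`p` number `m`,
  -- while `g ^ p = 1`.
  refine ⟨s, by_contra fun hne => hg1 ?_⟩
  obtain ⟨j, hj⟩ := key _ (pow_mem hz _) hne
  have h1 : (g : G ⧸ V.normalCore) ^ m = 1 := by
    rw [hj, ← zpow_natCast, zpow_comm, zpow_natCast, ← pow_mul, ← hsm, pow_orderOf_eq_one, one_zpow]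
  have h2 : orderOf (g : G ⧸ V.normalCore) ∣ Nat.gcd m p :=
    Nat.dvd_gcd (orderOf_dvd_of_pow_eq_one h1) (orderOf_dvd_of_pow_eq_one hgp1)
  rw [((Nat.Prime.coprime_iff_not_dvd hp).mpr hm).symm, Nat.dvd_one, orderOf_eq_one_iff] at h2
  exact h2

/-! ### Bounded nilpotent groups have the separation property. -/

/-- A natural number none of whose prime divisors lies in `P`. -/
def IsComplNumber (P : Set ℕ) (m : ℕ) : Prop :=
  m ≠ 0 ∧ ∀ q, q.Prime → q ∣ m → q ∉ P

theorem IsComplNumber.one (P : Set ℕ) : IsComplNumber P 1 :=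
  ⟨one_ne_zero, fun _ hq h => absurd (Nat.dvd_one.mp h) hq.ne_one⟩

theorem IsComplNumber.mul {P : Set ℕ} {m n : ℕ} (hm : IsComplNumber P m) (hn : IsComplNumber P n) :
    IsComplNumber P (m * n) :=
  ⟨mul_ne_zero hm.1 hn.1, fun q hq h => (hq.dvd_mul.mp h).elim (hm.2 q hq) (hn.2 q hq)⟩

theorem Subgroup.IsComplIsolated.mem_of_pow_mem {P : Set ℕ} {X : Type u} [Group X] {Y : Subgroup X}
    (hY : Y.IsComplIsolated P) (m : ℕ) (hm : IsComplNumber P m) (x : X) (hx : x ^ m ∈ Y) :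
    x ∈ Y := by
  induction m using induction_on_primes generalizing x with
  | zero => exact absurd rfl hm.1
  | one => simpa using hx
  | prime_mul q a hq ih =>
    rw [pow_mul] at hx
    have ha : IsComplNumber P a := ⟨fun h => hm.1 (by simp [h]), fun r hr h =>
      hm.2 r hr (h.mul_left q)⟩
    exact hY x q hq (hm.2 q hq (dvd_mul_right q a)) (ih ha _ hx)

namespace GroupClass

variable {C : GroupClass.{u}}

/-- Let `h` be a central element none of whose `P'`-powers lies in `Y`. Then a power of `h` has
order `p ∈ P` modulo some subgroup containing `Y`. -/
theorem exists_pow_notMem_of_center {P : Set ℕ} {p₀ : ℕ} (hp₀ : p₀ ∈ P) (hP : ∀ p ∈ P, p.Prime)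
    {Q : Type u} [Group Q] (Y : Subgroup Q) {h : Q}
    (hc : h ∈ Subgroup.center Q) (hY : ∀ m, IsComplNumber P m → h ^ m ∉ Y) :
    ∃ p ∈ P, ∃ (r : ℕ) (Y' : Subgroup Q), Y ≤ Y' ∧ h ^ r ∉ Y' ∧ (h ^ r) ^ p ∈ Y' := by
  -- The least positive `r` with `h ^ r ∈ Y` has a prime divisor in `P`, which is divided out. If
  -- there is no such `r`, adjoining `h ^ p₀` to `Y` does not capture `h`: that would put `h ^ (1 -
  -- p₀ * k)` in `Y`.
  by_cases hr : ∃ r : ℕ, 0 < r ∧ h ^ r ∈ Y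
  · classical
    obtain ⟨hr0, hrY⟩ := Nat.find_spec hr
    have hmin := fun {m} => Nat.find_min (m := m) hr
    set r := Nat.find hr
    obtain ⟨p, hpp, hpr, hpP⟩ : ∃ p, p.Prime ∧ p ∣ r ∧ p ∈ P := by
      by_contra! hcon
      exact hY r ⟨hr0.ne', hcon⟩ hrY
    obtain ⟨s, hs⟩ := hpr
    have hs0 : 0 < s := Nat.pos_of_ne_zero fun h0 => by simp [h0] at hs; omega
    refine ⟨p, hpP, s, Y, le_rfl, fun hsY => hmin ?_ ⟨hs0, hsY⟩, ?_⟩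
    · rw [hs]
      exact lt_mul_of_one_lt_left hs0 hpp.one_lt
    · rwa [← pow_mul, mul_comm, ← hs]
  · push Not at hr
    have hn : (Subgroup.zpowers (h ^ p₀)).Normal := by
      refine ⟨fun n hn y => ?_⟩
      rw [Subgroup.mem_center_iff.mp
        ((Subgroup.zpowers_le (H := Subgroup.center _)).mpr (pow_mem hc p₀) hn) y,
        mul_inv_cancel_right]
      exact hn
    refine ⟨p₀, hp₀, 1, Y ⊔ Subgroup.zpowers (h ^ p₀), le_sup_left, fun hmem => ?_, ?_⟩
    · rw [pow_one] at hmem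
      obtain ⟨y, hy, w, hw, hyw⟩ := Subgroup.mem_sup_of_normal_right.mp hmem
      obtain ⟨k, rfl⟩ := Subgroup.mem_zpowers_iff.mp hw
      have h1 : h ^ (1 - p₀ * k : ℤ) ∈ Y := by
        rw [zpow_sub, zpow_one, zpow_mul, zpow_natCast]
        nth_rw 1 [← hyw]
        rwa [mul_inv_cancel_right]
      have h2 : (1 - p₀ * k : ℤ) ≠ 0 := by
        intro h0
        have : (p₀ : ℤ) ∣ 1 := ⟨k, by linarith⟩
        exact (hP p₀ hp₀).ne_one (by exact_mod_cast Int.eq_one_of_dvd_one (by positivity) this)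
      have h3 : h ^ (1 - p₀ * k : ℤ).natAbs ∈ Y := by
        rcases Int.natAbs_eq (1 - p₀ * k : ℤ) with h4 | h4
        · rwa [← zpow_natCast, ← h4]
        · rw [← zpow_natCast, ← inv_mem_iff, ← zpow_neg, ← h4]
          exact h1
      exact hr _ (Int.natAbs_pos.mpr h2) h3
    · rw [pow_one]
      exact Subgroup.mem_sup_right (Subgroup.mem_zpowers _)

theorem IsRoot.exists_separating_of_center (hC : C.IsRoot) (hper : C.IsPeriodic) {Q : Type u}
    [Group Q] [Group.IsNilpotent Q] (hQ : C.IsBoundedNilpotent Q) (Y : Subgroup Q) {h : Q}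
    (hc : h ∈ Subgroup.center Q) (hY : ∀ m, IsComplNumber C.primes m → h ^ m ∉ Y) :
    ∃ (K : Type u) (_ : Group K) (σ : Q →* K), C K ∧ Function.Surjective σ ∧ σ h ∉ Y.map σ := by
  obtain ⟨p₀, hp₀⟩ := hC.exists_mem_primes hper
  obtain ⟨p, hp, r, Y', hYY', hr, hrp⟩ := exists_pow_notMem_of_center hp₀ (fun p hp => hp.1) Y hc hY
  obtain ⟨V, hV, hgV, hmax⟩ := Y'.exists_le_maximal_notMem hr
  have hs := QuotientGroup.mk'_surjective V.normalCore
  refine ⟨Q ⧸ V.normalCore, _, QuotientGroup.mk' _,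
    hC.of_isBoundedNilpotent (hQ.of_surjective _ hs) hp
      (Subgroup.center_quotient_normalCore_le hp.1 (pow_mem hc r) hgV (hV hrp) hmax), hs, ?_⟩
  rintro ⟨y, hy, hyh⟩
  -- The kernel is inside `V`, which also contains `Y`, so equal images would force `h ∈ V`.
  have h1 : y⁻¹ * h ∈ V := V.normalCore_le (QuotientGroup.eq.mp hyh)
  have h2 : h ∈ V := (Subgroup.mul_mem_cancel_left V (inv_mem (hV (hYY' hy)))).mp h1
  exact hgV (pow_mem h2 r)

theorem IsBoundedNilpotent.hasSep (hC : C.IsRoot) (hper : C.IsPeriodic) {X : Type u}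
    [Group X] [Group.IsNilpotent X] (hX : C.IsBoundedNilpotent X) : C.HasSep X := by
  intro Y hY x hx
  obtain ⟨n, H, hN, h0, hn, hc, hb⟩ := id hX
  have hex : ∃ i, i ≤ n ∧ ∃ m, IsComplNumber C.primes m ∧ x ^ m ∈ Y ⊔ H i :=
    ⟨n, le_rfl, 1, IsComplNumber.one _, by simp [hn]⟩
  classical
  obtain ⟨hi, m, hm, hxm⟩ := Nat.find_spec hex
  have hmin := fun {m} => Nat.find_min (m := m) hex
  generalize Nat.find hex = i at hi hxm hmin
  cases i with
  | zero =>
    rw [h0, sup_bot_eq] at hxm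
    exact absurd (hY.mem_of_pow_mem m hm x hxm) hx
  | succ i =>
    obtain ⟨y, hy, h, hh, hyh⟩ := Subgroup.mem_sup_of_normal_right.mp hxm
    let π := QuotientGroup.mk' (H i)
    have hπ : Function.Surjective π := QuotientGroup.mk'_surjective _
    have hcen : π h ∈ Subgroup.center (X ⧸ H i) := by
      rw [Subgroup.mem_center_iff]
      intro q
      obtain ⟨z, rfl⟩ := hπ q
      have h1 : ⁅h, z⁆ ∈ H i := (hc i hi).2 (Subgroup.commutator_mem_commutator hh trivial)
      have h2 : π ⁅h, z⁆ = 1 := (QuotientGroup.eq_one_iff _).mpr h1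
      rw [map_commutatorElement, commutatorElement_eq_one_iff_commute] at h2
      exact h2.eq.symm
    have hpow : ∀ k, IsComplNumber C.primes k → π h ^ k ∉ Y.map π := by
      intro k hk hmem
      -- Since `π h` is central, `π (x ^ (m * k))` is `π y ^ k * π h ^ k`; if it were in the image
      -- of `Y`, the lower index `i` would do.
      refine hmin (Nat.lt_succ_self i) ⟨by omega, m * k, hm.mul hk, ?_⟩
      have h1 : π (x ^ (m * k)) ∈ Y.map π := by
        have hcomm : Commute (π y) (π h) := Subgroup.mem_center_iff.mp hcen (π y)
        rw [pow_mul, map_pow, ← hyh, map_mul, hcomm.mul_pow, ← map_pow]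
        exact mul_mem (Subgroup.mem_map_of_mem π (pow_mem hy k)) hmem
      have h2 : x ^ (m * k) ∈ (Y.map π).comap π := h1
      rwa [Subgroup.comap_map_eq, QuotientGroup.ker_mk'] at h2
    obtain ⟨K, _, σ, hK, hσ, hne⟩ := hC.exists_separating_of_center hper (hX.of_surjective π hπ)
      (Y.map π) hcen hpow
    refine ⟨K, _, σ.comp π, hK, hσ.comp hπ, fun hmem => hne ?_⟩
    rw [← Subgroup.map_map] at hmem
    have h1 := pow_mem hmem m
    rw [MonoidHom.comp_apply, ← map_pow, ← map_pow, ← hyh, map_mul, map_mul] at h1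
    exact (Subgroup.mul_mem_cancel_left _
      (Subgroup.mem_map_of_mem σ (Subgroup.mem_map_of_mem π hy))).mp h1

end GroupClass

/-! ### Torsion-free abelian groups without divisible `p`-sections. -/

/-- There is no non-trivial section `S / M` of `A` which is a `p`-divisible `p`-group. -/
def HasNoDivisibleSection (p : ℕ) (A : Type*) [AddCommGroup A] : Prop :=
  ∀ M S : AddSubgroup A, M ≤ S → (∀ s ∈ S, ∃ k : ℕ, p ^ k • s ∈ M) →
    (∀ s ∈ S, ∃ t ∈ S, s - p • t ∈ M) → S ≤ M

/-- Sending the `n`-th basis vector to `p ^ (-(n + 1))` maps the free group to `ℤ[1/p]`; modulo `ℤ`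
this yields the Prüfer group. -/
theorem exists_pow_mul_linearCombination_eq_int {p : ℕ} (hp : p ≠ 0) (c : ℕ →₀ ℤ) :
    ∃ (k : ℕ) (a : ℤ),
      (p : ℚ) ^ k * Finsupp.linearCombination ℤ (fun n => ((p : ℚ) ^ (n + 1))⁻¹) c = a := by
  have hp' : (p : ℚ) ≠ 0 := by exact_mod_cast hp
  induction c using Finsupp.induction_linear with
  | zero => exact ⟨0, 0, by simp⟩
  | add f g hf hg =>
    obtain ⟨k, a, h⟩ := hf
    obtain ⟨l, b, h'⟩ := hg
    refine ⟨k + l, p ^ l * a + p ^ k * b, ?_⟩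
    push_cast
    rw [map_add, ← h, ← h']
    ring
  | single n z =>
    refine ⟨n + 1, z, ?_⟩
    rw [Finsupp.linearCombination_single, zsmul_eq_mul]
    field_simp

section

variable {A : Type*} [AddCommGroup A] {p : ℕ}

/-- An integral relation is trivial modulo `p`, and torsion-freeness allows division by `p`.
Repeating this makes every coefficient divisible by all powers of `p`. -/
theorem linearIndependent_int_of_zmod (hp : p.Prime)
    (htf : ∀ (n : ℕ) (a : A), n ≠ 0 → n • a = 0 → a = 0) {V : Type*} [AddCommGroup V]
    [Module (ZMod p) V] (f : A →+ V) {x : ℕ → A}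
    (hx : LinearIndependent (ZMod p) (fun n => f (x n))) : LinearIndependent ℤ x := by
  have hdiv : ∀ c : ℕ →₀ ℤ, Finsupp.linearCombination ℤ x c = 0 →
      ∃ d : ℕ →₀ ℤ, c = (p : ℤ) • d ∧ Finsupp.linearCombination ℤ x d = 0 := by
    intro c hc
    have h1 : ∀ n, ((c n : ℤ) : ZMod p) = 0 := by
      have h2 := (linearIndependent_iff.mp hx) (c.mapRange (Int.cast : ℤ → ZMod p) Int.cast_zero)
        (by
          rw [Finsupp.linearCombination_apply, Finsupp.sum_mapRange_index (by simp)]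
          have h3 := congrArg f hc
          rw [Finsupp.linearCombination_apply, map_finsuppSum, map_zero] at h3
          rw [← h3]
          refine Finsupp.sum_congr fun n _ => ?_
          rw [map_zsmul, Int.cast_smul_eq_zsmul])
      intro n
      simpa using DFunLike.congr_fun h2 n
    have h2 : c = (p : ℤ) • c.mapRange (fun z => z / (p : ℤ)) (Int.zero_ediv _) := by
      ext n
      obtain ⟨z, hz⟩ := (ZMod.intCast_zmod_eq_zero_iff_dvd (c n) p).mp (h1 n)
      have : (p : ℤ) ≠ 0 := by exact_mod_cast hp.ne_zero
      rw [Finsupp.smul_apply, Finsupp.mapRange_apply, hz, Int.mul_ediv_cancel_left _ this,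
        smul_eq_mul]
    refine ⟨_, h2, ?_⟩
    rw [h2, map_smul, natCast_zsmul] at hc
    exact htf p _ hp.ne_zero hc
  rw [linearIndependent_iff]
  intro c hc
  have hpow : ∀ s : ℕ, ∃ d : ℕ →₀ ℤ, c = (p ^ s : ℤ) • d ∧ Finsupp.linearCombination ℤ x d = 0 := by
    intro s
    induction s with
    | zero => exact ⟨c, by simp, hc⟩
    | succ s ih =>
      obtain ⟨d, rfl, hd⟩ := ih
      obtain ⟨d', rfl, hd'⟩ := hdiv d hd
      exact ⟨d', by rw [smul_smul, pow_succ], hd'⟩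
  ext n
  refine Int.eq_zero_of_abs_lt_dvd (m := p ^ (c n).natAbs) ?_ ?_
  · obtain ⟨d, hd, -⟩ := hpow (c n).natAbs
    exact ⟨d n, by conv_lhs => rw [hd]; simp⟩
  · rw [Int.abs_eq_natAbs]
    exact_mod_cast Nat.lt_pow_self hp.one_lt

/-- An independent sequence spans a free group of countable rank, which has the Prüfer group as a
quotient. -/
theorem HasNoDivisibleSection.not_linearIndependent (hp : p.Prime) (hA : HasNoDivisibleSection p A)
    (x : ℕ → A) : ¬ LinearIndependent ℤ x := by
  intro hx
  have hp' : (p : ℚ) ≠ 0 := by exact_mod_cast hp.ne_zero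
  let φ := (Finsupp.linearCombination ℤ (fun n : ℕ => ((p : ℚ) ^ (n + 1))⁻¹)).toAddMonoidHom
  let l := (Finsupp.linearCombination ℤ x).toAddMonoidHom
  let M₀ : AddSubgroup (ℕ →₀ ℤ) := (Int.castAddHom ℚ).range.comap φ
  have hle : l.range ≤ M₀.map l := by
    refine hA (M₀.map l) l.range ?_ ?_ ?_
    · rintro _ ⟨c, -, rfl⟩
      exact ⟨c, rfl⟩
    · rintro _ ⟨c, rfl⟩
      obtain ⟨k, a, h⟩ := exists_pow_mul_linearCombination_eq_int hp.ne_zero c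
      refine ⟨k, p ^ k • c, ⟨a, ?_⟩, map_nsmul l _ _⟩
      rw [map_nsmul, nsmul_eq_mul]
      push_cast
      exact h.symm
    · rintro _ ⟨c, rfl⟩
      obtain ⟨k, a, h⟩ := exists_pow_mul_linearCombination_eq_int hp.ne_zero c
      -- As `φ c = a / p ^ k`, the vector `single k a` has `φ`-value `a / p ^ (k + 1)`, a `p`-th
      -- part of `φ c`.
      refine ⟨l (Finsupp.single k a), ⟨_, rfl⟩, c - p • Finsupp.single k a, ⟨0, ?_⟩, ?_⟩
      · rw [map_zero, map_sub, map_nsmul]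
        have h1 : φ (Finsupp.single k a) = a * ((p : ℚ) ^ (k + 1))⁻¹ := by
          simp [φ]
        have h2 : (p : ℚ) ^ k * φ c = a := h
        rw [h1, ← h2, nsmul_eq_mul]
        field_simp
        ring
      · rw [map_sub, map_nsmul]
  obtain ⟨c, ⟨a, ha⟩, hc⟩ := hle ⟨Finsupp.single 0 1, rfl⟩
  have h1 : c = Finsupp.single 0 1 := hx hc
  rw [h1] at ha
  have h2 : φ (Finsupp.single 0 1) = (p : ℚ)⁻¹ := by simp [φ]
  rw [h2] at ha
  have h3 : (a * p : ℚ) = 1 := by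
    change (a : ℚ) = _ at ha
    rw [ha, inv_mul_cancel₀ hp']
  have h4 : a * p = 1 := by exact_mod_cast h3
  have h5 : (p : ℤ) ∣ 1 := ⟨a, by linarith⟩
  exact hp.ne_one (by exact_mod_cast Int.eq_one_of_dvd_one (Int.natCast_nonneg p) h5)

theorem exists_linearIndependent_nat_zmod (p : ℕ) [Fact p.Prime] (V : Type*) [AddCommGroup V]
    [Module (ZMod p) V] [Infinite V] : ∃ v : ℕ → V, LinearIndependent (ZMod p) v := by
  let b := Module.Basis.ofVectorSpace (ZMod p) V
  have hι : Infinite (Module.Basis.ofVectorSpaceIndex (ZMod p) V) := by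
    by_contra hfin
    rw [not_infinite_iff_finite] at hfin
    have : Module.Finite (ZMod p) V := Module.Finite.of_basis b
    exact not_finite_iff_infinite.mpr ‹_› (Module.finite_of_finite (ZMod p))
  let e := Infinite.natEmbedding (Module.Basis.ofVectorSpaceIndex (ZMod p) V)
  exact ⟨_, b.linearIndependent.comp e e.injective⟩

theorem HasNoDivisibleSection.finite_quotient (hp : p.Prime) (hA : HasNoDivisibleSection p A)
    (htf : ∀ (n : ℕ) (a : A), n ≠ 0 → n • a = 0 → a = 0) :
    Finite (A ⧸ (nsmulAddMonoidHom (α := A) p).range) := by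
  have : Fact p.Prime := ⟨hp⟩
  let _ : Module (ZMod p) (A ⧸ (nsmulAddMonoidHom (α := A) p).range) :=
    QuotientAddGroup.zmodModule fun a => ⟨a, rfl⟩
  by_contra hinf
  rw [not_finite_iff_infinite] at hinf
  obtain ⟨v, hv⟩ := exists_linearIndependent_nat_zmod p (A ⧸ (nsmulAddMonoidHom (α := A) p).range)
  choose x hx using fun n =>
    QuotientAddGroup.mk'_surjective (nsmulAddMonoidHom (α := A) p).range (v n)
  refine hA.not_linearIndependent hp x (linearIndependent_int_of_zmod hp htf
    (QuotientAddGroup.mk' (nsmulAddMonoidHom (α := A) p).range) ?_)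
  simpa only [hx] using hv

/-- Let `S / M` be the `p`-torsion of `A / M`. Finitely many elements of `S` represent its image in
`A / pA`; modulo `M` and these, `S` is a `p`-divisible `p`-group, hence trivial. So `S / M` is
finitely generated and torsion. -/
theorem HasNoDivisibleSection.finite_pPrimary (hp : p.Prime)
    (hA : HasNoDivisibleSection p A) (htf : ∀ (n : ℕ) (a : A), n ≠ 0 → n • a = 0 → a = 0)
    (M : AddSubgroup A) :
    Finite {b : A ⧸ M | ∃ k : ℕ, p ^ k • b = 0} := by
  have hfin := hA.finite_quotient hp htf
  let S : AddSubgroup A :=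
    { carrier := {a | ∃ k : ℕ, p ^ k • a ∈ M}
      zero_mem' := ⟨0, by simp⟩
      add_mem' := by
        rintro a b ⟨k, hk⟩ ⟨l, hl⟩
        refine ⟨k + l, ?_⟩
        rw [smul_add]
        refine add_mem ?_ ?_
        · rw [pow_add, mul_comm, mul_smul]
          exact nsmul_mem hk _
        · rw [pow_add, mul_smul]
          exact nsmul_mem hl _
      neg_mem' := by
        rintro a ⟨k, hk⟩
        exact ⟨k, by rw [smul_neg]; exact neg_mem hk⟩ }
  let π := QuotientAddGroup.mk' (nsmulAddMonoidHom (α := A) p).range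
  -- finitely many representatives of the image of `S` modulo `p`
  obtain ⟨R, hRfin, hR⟩ : ∃ R : Set A, R.Finite ∧ R ⊆ S ∧ ∀ s ∈ S, ∃ r ∈ R, π r = π s := by
    obtain ⟨R, hRS, hbij⟩ := Set.SurjOn.exists_bijOn_subset (Set.surjOn_image π (S : Set A))
    refine ⟨R, hbij.finite_iff_finite.mpr (Set.toFinite _), hRS, fun s hs => ?_⟩
    exact hbij.surjOn ⟨s, hs, rfl⟩
  obtain ⟨hRS, hR⟩ := hR
  have hMS : M ≤ S := fun a ha => ⟨0, by simpa using ha⟩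
  have hFS : M ⊔ AddSubgroup.closure R ≤ S := sup_le hMS ((AddSubgroup.closure_le S).mpr hRS)
  have hSF : S ≤ M ⊔ AddSubgroup.closure R := by
    refine hA _ S hFS ?_ ?_
    · rintro s ⟨k, hk⟩
      exact ⟨k, (le_sup_left : M ≤ _) hk⟩
    · intro s hs
      obtain ⟨r, hr, hrs⟩ := hR s hs
      obtain ⟨a, ha⟩ := QuotientAddGroup.eq.mp hrs
      have ha : p • a = -r + s := ha
      have hpa : p • a ∈ S := ha ▸ add_mem (neg_mem (hRS hr)) hs
      obtain ⟨k, hk⟩ := hpa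
      -- From `p • a ∈ S` it follows that `a ∈ S`, so division by `p` stays inside `S`.
      refine ⟨a, ⟨k + 1, by rwa [pow_succ, mul_smul]⟩, ?_⟩
      rw [ha, show s - (-r + s) = r by abel]
      exact (le_sup_right : AddSubgroup.closure R ≤ _) (AddSubgroup.subset_closure hr)
  have himg : S.map (QuotientAddGroup.mk' M) =
      AddSubgroup.closure (QuotientAddGroup.mk' M '' R) := by
    apply le_antisymm
    · refine (AddSubgroup.map_mono hSF).trans ?_
      rw [AddSubgroup.map_sup, AddMonoidHom.map_closure]
      simp
    · rw [← AddMonoidHom.map_closure]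
      exact AddSubgroup.map_mono (le_sup_right.trans hFS)
  have hfg : AddGroup.FG (S.map (QuotientAddGroup.mk' M)) := by
    rw [AddGroup.fg_iff_addSubgroup_fg, AddSubgroup.fg_iff]
    exact ⟨_, himg.symm, hRfin.image _⟩
  have htor : IsAddTorsion (S.map (QuotientAddGroup.mk' M)) := by
    rintro ⟨_, s, ⟨k, hk⟩, rfl⟩
    refine isOfFinAddOrder_iff_nsmul_eq_zero.mpr ⟨p ^ k, pow_pos hp.pos k, ?_⟩
    ext
    exact (QuotientAddGroup.eq_zero_iff _).mpr hk
  have hfin' := AddCommGroup.finite_of_fg_isAddTorsion _ htor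
  refine Set.Finite.subset (s := (S.map (QuotientAddGroup.mk' M) : Set (A ⧸ M))) hfin' ?_
  rintro b ⟨k, hk⟩
  obtain ⟨a, rfl⟩ := QuotientAddGroup.mk'_surjective M b
  exact ⟨a, ⟨k, (QuotientAddGroup.eq_zero_iff _).mp hk⟩, rfl⟩

end

theorem AddSubgroup.mem_of_coprime_nsmul_mem {A : Type*} [AddCommGroup A] (M : AddSubgroup A)
    {m n : ℕ} (h : Nat.Coprime m n) {a : A} (hm : m • a ∈ M) (hn : n • a ∈ M) : a ∈ M := by
  obtain ⟨u, v, huv⟩ := Nat.isCoprime_iff_coprime.mpr h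
  have h1 : a = u • (m • a) + v • (n • a) := by
    rw [← natCast_zsmul a m, ← natCast_zsmul a n, ← mul_smul, ← mul_smul, ← add_smul, huv, one_smul]
  rw [h1]
  exact add_mem (zsmul_mem hm u) (zsmul_mem hn v)

/-- A section which is a `p`-divisible `p`-group is divisible. -/
theorem AddSubgroup.exists_sub_nsmul_mem {A : Type*} [AddCommGroup A] {M S : AddSubgroup A} {p : ℕ}
    (hp : p.Prime) (ht : ∀ s ∈ S, ∃ k : ℕ, p ^ k • s ∈ M)
    (hd : ∀ s ∈ S, ∃ t ∈ S, s - p • t ∈ M) (n : ℕ) (hn : n ≠ 0) :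
    ∀ s ∈ S, ∃ t ∈ S, s - n • t ∈ M := by
  have hprime : ∀ q : ℕ, q.Prime → ∀ s ∈ S, ∃ t ∈ S, s - q • t ∈ M := by
    intro q hq s hs
    by_cases hqp : q = p
    · exact hqp ▸ hd s hs
    obtain ⟨k, hk⟩ := ht s hs
    obtain ⟨u, v, huv⟩ := Nat.isCoprime_iff_coprime.mpr
      (((Nat.coprime_primes hq hp).mpr hqp).pow_right k)
    refine ⟨u • s, zsmul_mem hs u, ?_⟩
    have h1 : s - q • (u • s) = v • (p ^ k • s) := by
      rw [← natCast_zsmul _ q, ← natCast_zsmul _ (p ^ k), ← mul_smul, ← mul_smul, sub_eq_iff_eq_add,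
        ← add_smul, add_comm, mul_comm, huv, one_smul]
    rw [h1]
    exact zsmul_mem hk v
  induction n using induction_on_primes with
  | zero => exact absurd rfl hn
  | one => exact fun s hs => ⟨s, hs, by simp⟩
  | prime_mul q a hq ih =>
    intro s hs
    obtain ⟨t, ht', h1⟩ := hprime q hq s hs
    obtain ⟨w, hw, h2⟩ := ih (fun h => hn (by simp [h])) t ht'
    refine ⟨w, hw, ?_⟩
    have h3 : s - (q * a) • w = (s - q • t) + q • (t - a • w) := by
      rw [smul_sub, mul_smul]; abel
    rw [h3]
    exact add_mem h1 (nsmul_mem h2 q)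

/-! ### From separability to boundedness of abelian factors. -/

namespace GroupClass

variable {C : GroupClass.{u}}

theorem HasSep.hasNoDivisibleSection (hC : C.IsRoot) (hper : C.IsPeriodic) {X : Type u} [Group X]
    (hX : C.HasSep X) {Z : Subgroup X} (hZ : ∀ (n : ℕ) (x : X), n ≠ 0 → x ^ n ∈ Z → x ∈ Z)
    {A : Type*} [CommGroup A] (π : Z →* A) (hπ : Function.Surjective π) {p : ℕ}
    (hp : p ∈ C.primes) : HasNoDivisibleSection p (Additive A) := by
  intro M S _ ht hd s hs
  by_contra hsM
  -- Closing `M` under prime-to-`p` roots makes its preimage isolated. The closure still misses `s`,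
  -- because `S / M` is a `p`-group.
  let Y₀ : AddSubgroup (Additive A) :=
    { carrier := {a | ∃ m : ℕ, ¬ p ∣ m ∧ m • a ∈ M}
      zero_mem' := ⟨1, hp.1.not_dvd_one, by simp⟩
      add_mem' := by
        rintro a b ⟨k, hk, hka⟩ ⟨l, hl, hlb⟩
        refine ⟨k * l, fun h => (hp.1.dvd_mul.mp h).elim hk hl, ?_⟩
        rw [smul_add]
        refine add_mem ?_ ?_
        · rw [mul_comm, mul_smul]
          exact nsmul_mem hka _
        · rw [mul_smul]
          exact nsmul_mem hlb _
      neg_mem' := by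
        rintro a ⟨k, hk, hka⟩
        exact ⟨k, hk, by rw [smul_neg]; exact neg_mem hka⟩ }
  let Y : Subgroup X := ((AddSubgroup.toSubgroup' Y₀).comap π).map Z.subtype
  have hY : Y.IsComplIsolated C.primes := by
    rintro x q hq hqP ⟨z, ⟨m, hm, hmz⟩, hzx⟩
    have hxZ : x ∈ Z := hZ q x hq.ne_zero (hzx ▸ z.2)
    refine ⟨⟨x, hxZ⟩, ⟨m * q, fun h => (hp.1.dvd_mul.mp h).elim hm fun h' => hqP ?_, ?_⟩, rfl⟩
    · rwa [← (Nat.prime_dvd_prime_iff_eq hp.1 hq).mp h']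
    · have h1 : z = ⟨x, hxZ⟩ ^ q := Subtype.ext hzx
      rw [h1, map_pow] at hmz
      rw [mul_smul]
      exact hmz
  obtain ⟨z, hz⟩ := hπ s.toMul
  have hzY : (z : X) ∉ Y := by
    rintro ⟨z', ⟨m, hm, hmz⟩, hzz'⟩
    have h1 : z' = z := Subtype.ext hzz'
    rw [h1, hz] at hmz
    obtain ⟨k, hk⟩ := ht s hs
    exact hsM (M.mem_of_coprime_nsmul_mem
      (((Nat.Prime.coprime_iff_not_dvd hp.1).mpr hm).symm.pow_right k) hmz hk)
  obtain ⟨K, _, σ, hK, -, hne⟩ := hX Y hY z hzY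
  obtain ⟨n, hn, hpow⟩ := hC.exists_pow_eq_one hper hK
  obtain ⟨t, -, hst⟩ := AddSubgroup.exists_sub_nsmul_mem hp.1 ht hd n hn.ne' s hs
  obtain ⟨w, hw⟩ := hπ t.toMul
  -- Modulo `M`, `s` is `n • t`, and `w ^ n` dies in `K` of exponent `n`; so `z` has the same image
  -- as `z * (w ^ n)⁻¹ ∈ Y`.
  refine hne ⟨(z * (w ^ n)⁻¹ : Z), ⟨z * (w ^ n)⁻¹, ⟨1, hp.1.not_dvd_one, ?_⟩, rfl⟩, ?_⟩
  · rw [one_smul, map_mul, map_inv, map_pow, hz, hw]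
    rwa [sub_eq_add_neg] at hst
  · simp [hpow]

/-- The relevant torsion sets are finite, and `C` contains groups at least as large as any given
finite set. -/
theorem IsRoot.isBoundedAbelian (hC : C.IsRoot) (hper : C.IsPeriodic) {A : Type u} [CommGroup A]
    (htf : ∀ (n : ℕ) (a : A), n ≠ 0 → a ^ n = 1 → a = 1)
    (hA : ∀ p ∈ C.primes, HasNoDivisibleSection p (Additive A)) : C.IsBoundedAbelian A := by
  have hfin : ∀ (M : Subgroup A) [M.Normal], ∀ p ∈ C.primes, (pPowerTorsion p (A ⧸ M)).Finite := by
    intro M _ p hp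
    have h1 := (hA p hp).finite_pPrimary hp.1 (fun n a hn h => htf n a hn h) M.toAddSubgroup
    let φ : Additive A ⧸ M.toAddSubgroup →+ Additive (A ⧸ M) :=
      QuotientAddGroup.lift _ (MonoidHom.toAdditive (QuotientGroup.mk' M))
        fun a ha => (QuotientGroup.eq_one_iff (N := M) a.toMul).mpr ha
    have h1 : {b : Additive A ⧸ M.toAddSubgroup | ∃ k : ℕ, p ^ k • b = 0}.Finite := h1
    refine (h1.image fun b => (φ b).toMul).subset ?_
    rintro b ⟨k, hk⟩
    obtain ⟨a, rfl⟩ := QuotientGroup.mk_surjective b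
    refine ⟨QuotientAddGroup.mk' _ (Additive.ofMul a), ⟨k, ?_⟩, rfl⟩
    rw [← QuotientGroup.mk_pow, QuotientGroup.eq_one_iff] at hk
    exact (QuotientAddGroup.eq_zero_iff _).mpr hk
  refine ⟨mul_comm, fun M _ p hp => ?_, fun M _ p hp => ?_⟩
  · let e : ℕ := ∏ b ∈ (hfin M p hp).toFinset, orderOf b
    have hpos : ∀ b ∈ pPowerTorsion p (A ⧸ M), 0 < orderOf b := by
      rintro b ⟨k, hk⟩
      exact orderOf_pos_iff.mpr (isOfFinOrder_iff_pow_eq_one.mpr ⟨_, pow_pos hp.1.pos k, hk⟩)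
    refine ⟨e, Finset.prod_pos fun b hb => hpos b ((hfin M p hp).mem_toFinset.mp hb),
      fun b hb => orderOf_dvd_iff_pow_eq_one.mp (Finset.dvd_prod_of_mem _ ?_)⟩
    exact (hfin M p hp).mem_toFinset.mpr hb
  · obtain ⟨K, _, hK, h⟩ := hC.exists_le_card hper (Nat.card (pPowerTorsion p (A ⧸ M)))
    have := (hfin M p hp).to_subtype
    exact ⟨K, _, hK, by rwa [Nat.cast_card] at h⟩

end GroupClass

/-! ### The upper central series of a torsion-free nilpotent group. -/

/-- The factors of the upper central series of a torsion-free group are torsion-free. -/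
theorem Subgroup.mem_upperCentralSeries_of_pow_mem_of_mem_succ {X : Type*} [Group X]
    (htf : ∀ x : X, IsOfFinOrder x → x = 1) {n : ℕ} (hn : n ≠ 0) (i : ℕ) :
    ∀ x ∈ Subgroup.upperCentralSeries X (i + 1), x ^ n ∈ Subgroup.upperCentralSeries X i →
      x ∈ Subgroup.upperCentralSeries X i := by
  induction i with
  | zero =>
    intro x _ hx
    rw [Subgroup.upperCentralSeries_zero, Subgroup.mem_bot] at hx ⊢
    exact htf x (isOfFinOrder_iff_pow_eq_one.mpr ⟨n, Nat.pos_of_ne_zero hn, hx⟩)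
  | succ i ih =>
    intro x hx hxn
    rw [Subgroup.mem_upperCentralSeries_succ_iff] at hx hxn ⊢
    intro y
    refine ih _ (hx y) ?_
    rw [← Subgroup.commutatorElement_pow_mem_iff _
      (Subgroup.mem_upperCentralSeries_succ_iff.mp (hx y) x)]
    exact hxn y

/-- Nilpotency places `x` in some term; it then descends one torsion-free factor at a time. -/
theorem Subgroup.mem_upperCentralSeries_of_pow_mem {X : Type*} [Group X] [Group.IsNilpotent X]
    (htf : ∀ x : X, IsOfFinOrder x → x = 1) (i n : ℕ) (x : X) (hn : n ≠ 0)
    (hx : x ^ n ∈ Subgroup.upperCentralSeries X i) : x ∈ Subgroup.upperCentralSeries X i := by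
  have main : ∀ d, x ∈ Subgroup.upperCentralSeries X (i + d) →
      x ∈ Subgroup.upperCentralSeries X i := by
    intro d
    induction d with
    | zero => exact id
    | succ d ih =>
      intro h
      exact ih (Subgroup.mem_upperCentralSeries_of_pow_mem_of_mem_succ htf hn _ x h
        (Subgroup.upperCentralSeries_mono X (Nat.le_add_right i d) hx))
  refine main (Group.nilpotencyClass X) ?_
  exact Subgroup.upperCentralSeries_mono X (Nat.le_add_left _ _) (by simp)

/-- The upper central series is used because its terms contain all roots of their elements: this
makes the factors torsion-free and lets isolation inside a term pass to `X`. -/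
theorem GroupClass.HasSep.isBoundedNilpotent {C : GroupClass.{u}} (hC : C.IsRoot)
    (hper : C.IsPeriodic) {X : Type u} [Group X] [Group.IsNilpotent X]
    (htf : ∀ x : X, IsOfFinOrder x → x = 1) (hX : C.HasSep X) : C.IsBoundedNilpotent X := by
  refine ⟨Group.nilpotencyClass X, Subgroup.upperCentralSeries X, fun i => inferInstance,
    Subgroup.upperCentralSeries_zero X, Subgroup.upperCentralSeries_nilpotencyClass,
    fun i _ => ⟨Subgroup.upperCentralSeries_mono X (Nat.le_succ i),
      Subgroup.commutator_upperCentralSeries_top_le X i⟩, fun i _ => ?_⟩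
  let _ : CommGroup (Subgroup.upperCentralSeries X (i + 1) ⧸
      (Subgroup.upperCentralSeries X i).subgroupOf (Subgroup.upperCentralSeries X (i + 1))) :=
    { (inferInstance : Group (Subgroup.upperCentralSeries X (i + 1) ⧸
        (Subgroup.upperCentralSeries X i).subgroupOf (Subgroup.upperCentralSeries X (i + 1)))) with
      mul_comm := by
        intro a b
        obtain ⟨x, rfl⟩ := QuotientGroup.mk_surjective a
        obtain ⟨y, rfl⟩ := QuotientGroup.mk_surjective b
        rw [← commutatorElement_eq_one_iff_mul_comm]
        refine (QuotientGroup.eq_one_iff ⁅x, y⁆).mpr ?_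
        exact Subgroup.mem_upperCentralSeries_succ_iff.mp x.2 y }
  refine hC.isBoundedAbelian hper ?_ fun p hp => hX.hasNoDivisibleSection hC hper
    (Subgroup.mem_upperCentralSeries_of_pow_mem htf (i + 1)) _ (QuotientGroup.mk'_surjective _) hp
  intro n a hn ha
  obtain ⟨x, rfl⟩ := QuotientGroup.mk_surjective a
  have h1 := (QuotientGroup.eq_one_iff (x ^ n)).mp ha
  exact (QuotientGroup.eq_one_iff x).mpr
    (Subgroup.mem_upperCentralSeries_of_pow_mem htf i n x hn h1)

theorem corollary2p3 (C : GroupClass.{u}) (hC : C.IsRoot) (hper : C.IsPeriodic)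
    (X : Type u) [Group X] [Group.IsNilpotent X]
    (htf : ∀ x : X, IsOfFinOrder x → x = 1) :
    C.HasSep X ↔ C.IsBoundedNilpotent X :=
  ⟨fun h => h.isBoundedNilpotent hC hper htf, fun h => h.hasSep hC hper⟩
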